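/- Let $n \ge 1$. In the real vector space $\mathbb{R}^n/\mathbb{R}(1,\dots,1)$, write $e_1,\dots,e_n$ for the images of the standard basis vectors. Let $A_{n-1}=\{e_i-e_j : 1\le i<j\le n\}$ be the set of positive roots of type $A$, and let $\Lambda_W=\mathbb{Z}\{e_1,\dots,e_n\}$ (so that $e_1+\cdots+e_n=0$) be its weight lattice. For a finite subset $A$ of a lattice $\Lambda$ of rank $d$, and $B\subseteq A$, let $r(B)=\dim_{\mathbb{R}}\operatorname{span}_{\mathbb{R}}B$, let $m(B)$ be the index of $\mathbb{Z}B$ in $\operatorname{span}_{\mathbb{R}}B\cap\Lambda$, let $$M_A(x,y)=\sum_{B\subseteq A}m(B)\,(x-1)^{r(A)-r(B)}(y-1)^{|B|-r(B)}$$ be the arithmetic Tutte polynomial of $A$, and let $$\chi_A(q)=(-1)^{r(A)}\,q^{\,d-r(A)}\,M_A(1-q,0)$$ be the arithmetic characteristic polynomial of $A$, all with respect to $\Lambda$. Let $\chi^W_{A_{n-1}}(q)$ be the arithmetic characteristic polynomial of $A_{n-1}$ with respect to $\Lambda_W$. Then $$\chi^W_{A_{n-1}}(q)=\frac{n!}{q}\sum_{m\mid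 n}(-1)^{n-\frac nm}\,\varphi(m)\binom{q/m}{n/m}$$ as rational functions of $q$ over $\mathbb{Q}$ (equivalently, for every $q\neq 0$ in every field of characteristic $0$). Here $\varphi$ is Euler's totient function, the sum is over the positive divisors $m$ of $n$, and $\binom{z}{k}=z(z-1)\cdots(z-k+1)/k!$. In particular, when $n\ge 3$ is prime, $$\chi^W_{A_{n-1}}(q)=(q-1)(q-2)\cdots(q-n+1)+(n-1)\,(n-1)!$$ as polynomials in $q$. -/

import Mathlib

open Polynomial

noncomputable section

namespace ArithTutte

section General

variable {V : Type*} [AddCommGroup V] [Module ℝ V]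

/-- The rank `r(B)` of a finite set of vectors: the dimension of its real span. -/
def rk (B : Finset V) : ℕ :=
  Module.finrank ℝ (Submodule.span ℝ (B : Set V))

/-- The multiplicity `m(B)` of `B` with respect to the lattice `L`: the index of the subgroup `ℤB`
generated by `B` inside `span B ∩ L`, where `span B` is the real span of `B`. -/
def latticeMult (L : Submodule ℤ V) (B : Finset V) : ℕ :=
  (Submodule.span ℤ (B : Set V)).toAddSubgroup.relIndex
    ((Submodule.span ℝ (B : Set V)).restrictScalars ℤ ⊓ L).toAddSubgroup

/-- The arithmetic Tutte polynomial
`M_A(x, y) = ∑_{B ⊆ A} m(B) (x - 1)^(r(A) - r(B)) (y - 1)^(|B| - r(B))`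
of a finite subset `A` of the lattice `L`; here `x = X 0` and `y = X 1`. The truncated subtractions
are honest since `r(B) ≤ r(A)` and `r(B) ≤ |B|`. -/
def arithTutte (L : Submodule ℤ V) (A : Finset V) : MvPolynomial (Fin 2) ℤ :=
  ∑ B ∈ A.powerset,
    MvPolynomial.C (latticeMult L B : ℤ) * (MvPolynomial.X 0 - 1) ^ (rk A - rk B) *
      (MvPolynomial.X 1 - 1) ^ (B.card - rk B)

/-- The arithmetic characteristic polynomial
`χ_A(q) = (-1)^r q^(d - r) M_A(1 - q, 0)`, where `r` is the rank of `A` and `d` is the rank of the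
lattice `L` containing `A`. -/
def arithCharPoly (L : Submodule ℤ V) (A : Finset V) : ℤ[X] :=
  (-1) ^ rk A * X ^ (Module.finrank ℤ L - rk A) *
    MvPolynomial.aeval ![1 - X, 0] (arithTutte L A)

end General

section TypeA

/-- The real vector space `ℝⁿ / ℝ(1, …, 1)`, in which the weight lattice of `A_{n-1}` lives. -/
abbrev TypeASpace (n : ℕ) : Type :=
  (Fin n → ℝ) ⧸ Submodule.span ℝ {(fun _ => 1 : Fin n → ℝ)}

/-- The class of the standard basis vector `e_i` in `ℝⁿ / ℝ(1, …, 1)`. -/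
def typeAe (n : ℕ) (i : Fin n) : TypeASpace n :=
  Submodule.Quotient.mk (Pi.single i 1)

/-- The weight lattice of `A_{n-1}`, that is `ℤ{e_1, …, e_n} / (e_1 + ⋯ + e_n = 0)`. -/
def typeAWeightLattice (n : ℕ) : Submodule ℤ (TypeASpace n) :=
  Submodule.span ℤ (Set.range (typeAe n))

open Classical in
/-- The (positive) roots `{e_i - e_j : i < j}` of type `A_{n-1}`. -/
def typeARoots (n : ℕ) : Finset (TypeASpace n) :=
  (Finset.univ.filter fun p : Fin n × Fin n => p.1 < p.2).image
    fun p => typeAe n p.1 - typeAe n p.2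

/-- The arithmetic characteristic polynomial of `A_{n-1}` in its weight lattice. -/
def typeAWeightCharPoly (n : ℕ) : ℤ[X] :=
  arithCharPoly (typeAWeightLattice n) (typeARoots n)

end TypeA

end ArithTutte

end

noncomputable section

namespace ArithTutte

/-! ### Multiplicities, and homomorphism counts modulo q -/

section Lattice

open Module

/-! The finite field method over ℤ/q. For a lattice L of rank d, the homomorphisms L → ℤ/q killing B
number m(B) q^(d - r(B)) as soon as m(B) divides q (`card_hom_vanishing`, via Smith normal form).
Inclusion-exclusion over B ⊆ A then shows that, for A of full rank and suitably divisible q, χ_A(q)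
counts the homomorphisms that vanish nowhere on A (`eval_arithCharPoly_eq_card`).

For the roots in the weight lattice these are the n-tuples of distinct elements of ℤ/q with sum
zero. Detecting the sum with additive characters, each a ∈ ℤ/q contributes n! times the
X^n-coefficient of ∏_s (1 + ψ(sa) X), which equals (1 - (-X)^m)^(q/m) when a has order m. That
coefficient vanishes unless m ∣ n and is otherwise a signed binomial; there are φ(m) elements of
order m (`card_injective_sum_eq_zero`).

This proves the formula for infinitely many integers q. After multiplication by q both sides are
polynomials, so it holds identically. -/

theorem relIndex_span_smul {E ι : Type*} [AddCommGroup E] [Fintype ι] {u : ι → E}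
    (hu : LinearIndependent ℤ u) {a : ι → ℤ} (ha : ∀ i, a i ≠ 0) :
    (Submodule.span ℤ (Set.range fun i => a i • u i)).toAddSubgroup.relIndex
      (Submodule.span ℤ (Set.range u)).toAddSubgroup = ∏ i, (a i).natAbs := by
  classical
  have hau : LinearIndependent ℤ fun i => a i • u i := by
    rw [Fintype.linearIndependent_iff] at hu ⊢
    intro g hg i
    have := hu (fun i => g i * a i) (by simpa [mul_smul] using hg) i
    exact (mul_eq_zero.mp this).resolve_right (ha i)
  have hle : (Submodule.span ℤ (Set.range fun i => a i • u i)).toAddSubgroup ≤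
      (Submodule.span ℤ (Set.range u)).toAddSubgroup := by
    intro x hx
    have : Submodule.span ℤ (Set.range fun i => a i • u i) ≤ Submodule.span ℤ (Set.range u) := by
      rw [Submodule.span_le]
      rintro _ ⟨i, rfl⟩
      exact Submodule.smul_mem _ _ (Submodule.subset_span ⟨i, rfl⟩)
    exact this hx
  let b₁ : Basis ι ℤ (Submodule.span ℤ (Set.range fun i => a i • u i)).toAddSubgroup.toIntSubmodule :=
    Basis.span hau
  let b₂ : Basis ι ℤ (Submodule.span ℤ (Set.range u)).toAddSubgroup.toIntSubmodule :=
    Basis.span hu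
  rw [AddSubgroup.relIndex_eq_natAbs_det _ _ hle b₁ b₂]
  have hb : (fun i => (⟨b₁ i, hle (SetLike.coe_mem _)⟩ :
      (Submodule.span ℤ (Set.range u)).toAddSubgroup.toIntSubmodule)) =
      fun i => a i • b₂ i := by
    funext i
    apply Subtype.ext
    have h1 : ((b₁ i : _) : E) = a i • u i := congrArg Subtype.val (Basis.span_apply hau i)
    have h2 : ((b₂ i : _) : E) = u i := congrArg Subtype.val (Basis.span_apply hu i)
    rw [Submodule.coe_smul, h2]
    exact h1
  rw [hb]
  have := b₂.det.map_smul_univ a b₂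
  rw [this, Basis.det_self, smul_eq_mul, mul_one]
  exact map_prod Int.natAbsHom a Finset.univ

variable {V ι : Type*} [AddCommGroup V] [Module ℝ V] [Fintype ι]

/-- Smith normal form of ℤB inside the lattice. The number of invariant factors is the rank, and
their product is the multiplicity, because the saturation of ℤB is spanned by the basis vectors that
occur. -/
theorem exists_adapted_basis (v : Basis ι ℝ V) (B : Finset V)
    (hB : (B : Set V) ⊆ Submodule.span ℤ (Set.range v)) :
    ∃ (b : Basis ι ℤ (Submodule.span ℤ (Set.range v))) (n : ℕ) (f : Fin n ↪ ι) (a : Fin n → ℤ),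
      Submodule.span ℤ (B : Set V) =
        Submodule.span ℤ (Set.range fun i => a i • (b (f i) : V)) ∧
      rk B = n ∧ (∀ i, a i ≠ 0) ∧
      latticeMult (Submodule.span ℤ (Set.range v)) B = ∏ i, (a i).natAbs := by
  classical
  set L := Submodule.span ℤ (Set.range v) with hL
  obtain ⟨n, bM, bN, f, a, snf⟩ := Submodule.smithNormalForm (v.restrictScalars ℤ)
    ((Submodule.span ℤ (B : Set V)).comap L.subtype)
  have hBL : Submodule.span ℤ (B : Set V) ≤ L := Submodule.span_le.mpr hB
  set w : ι → V := fun i => (bM i : V) with hw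
  have hspanw : L = Submodule.span ℤ (Set.range w) := by
    have h := congrArg (Submodule.map L.subtype) bM.span_eq
    rw [Submodule.map_span, Submodule.map_top, Submodule.range_subtype, ← Set.range_comp] at h
    exact h.symm
  have htop : ⊤ ≤ Submodule.span ℝ (Set.range w) := by
    rw [← v.span_eq, Submodule.span_le]
    rintro _ ⟨i, rfl⟩
    have : v i ∈ Submodule.span ℤ (Set.range w) := by
      rw [← hspanw]; exact Submodule.subset_span ⟨i, rfl⟩
    exact Submodule.span_le_restrictScalars ℤ ℝ _ this
  -- A ℤ-basis of the lattice spans V over ℝ and has dim V elements, so it is also a real basis.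
  have hwR : LinearIndependent ℝ w :=
    linearIndependent_of_top_le_span_of_card_eq_finrank htop (finrank_eq_card_basis v).symm
  have hwZ : LinearIndependent ℤ w := bM.linearIndependent.map' L.subtype (by simp)
  have ha : ∀ i, a i ≠ 0 := by
    intro i h0
    have h := snf i
    rw [h0, zero_smul] at h
    exact bN.ne_zero i (Subtype.ext h)
  have h1 : Submodule.span ℤ (B : Set V) =
      Submodule.span ℤ (Set.range fun i => a i • w (f i)) := by
    have h := congrArg (Submodule.map (L.subtype ∘ₗ Submodule.subtype _)) bN.span_eq
    rw [Submodule.map_span, Submodule.map_top, LinearMap.range_comp, Submodule.range_subtype,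
      Submodule.map_comap_subtype, ← Set.range_comp, inf_eq_right.mpr hBL] at h
    rw [← h]
    congr 2
    funext i
    simp [hw, snf]
  have h2 : Submodule.span ℝ (B : Set V) = Submodule.span ℝ (Set.range (w ∘ f)) := by
    rw [← Submodule.span_span_of_tower ℤ ℝ (B : Set V), h1, Submodule.span_span_of_tower]
    apply le_antisymm
    · rw [Submodule.span_le]
      rintro _ ⟨i, rfl⟩
      have : a i • w (f i) = (a i : ℝ) • w (f i) := by
        rw [Int.cast_smul_eq_zsmul]
      simp only [this]
      exact Submodule.smul_mem _ _ (Submodule.subset_span ⟨i, rfl⟩)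
    · rw [Submodule.span_le]
      rintro _ ⟨i, rfl⟩
      have : (w ∘ f) i = (a i : ℝ)⁻¹ • (a i • w (f i)) := by
        rw [← Int.cast_smul_eq_zsmul ℝ, smul_smul, inv_mul_cancel₀ (by exact_mod_cast ha i),
          one_smul, Function.comp]
      rw [this]
      exact Submodule.smul_mem _ _ (Submodule.subset_span ⟨i, rfl⟩)
  -- Integer coordinates of a lattice vector are also its real coordinates, so those outside the
  -- range of `f` vanish.
  have h3 : (Submodule.span ℝ (B : Set V)).restrictScalars ℤ ⊓ L =
      Submodule.span ℤ (Set.range (w ∘ f)) := by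
    apply le_antisymm
    · rintro x ⟨hx1, hx2⟩
      rw [Submodule.coe_restrictScalars, SetLike.mem_coe, h2] at hx1
      rw [SetLike.mem_coe, hspanw, Submodule.mem_span_range_iff_exists_fun] at hx2
      obtain ⟨c, rfl⟩ := hx2
      let W := Basis.mk hwR htop
      have hW : ∀ i, W i = w i := fun i => Basis.mk_apply hwR htop i
      rw [show w ∘ f = W ∘ f from funext fun i => (hW _).symm, Set.range_comp,
        Basis.mem_span_image] at hx1
      have hrep : ∀ i, W.repr (∑ i, c i • w i) i = c i := by
        intro i
        have : ∑ i, c i • w i = ∑ i, (c i : ℝ) • W i := by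
          simp [hW, Int.cast_smul_eq_zsmul]
        rw [this, Basis.repr_sum_self]
      refine Submodule.sum_mem _ fun i _ => ?_
      by_cases hci : c i = 0
      · simp [hci]
      · have hi : i ∈ (W.repr (∑ i, c i • w i)).support := by
          rw [Finsupp.mem_support_iff, hrep]; exact_mod_cast hci
        obtain ⟨j, rfl⟩ := hx1 hi
        exact Submodule.smul_mem _ _ (Submodule.subset_span ⟨j, rfl⟩)
    · rw [Submodule.span_le]
      rintro _ ⟨i, rfl⟩
      refine ⟨?_, (bM (f i)).2⟩
      rw [Submodule.coe_restrictScalars, SetLike.mem_coe, h2]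
      exact Submodule.subset_span ⟨i, rfl⟩
  refine ⟨bM, n, f, a, h1, ?_, ha, ?_⟩
  · rw [rk, h2, finrank_span_eq_card (hwR.comp _ f.injective), Fintype.card_fin]
  · rw [latticeMult, h3, h1]
    exact relIndex_span_smul (hwZ.comp _ f.injective) ha

theorem latticeMult_ne_zero (v : Basis ι ℝ V) (B : Finset V)
    (hB : (B : Set V) ⊆ Submodule.span ℤ (Set.range v)) :
    latticeMult (Submodule.span ℤ (Set.range v)) B ≠ 0 := by
  obtain ⟨b, n, f, a, -, -, ha, hm⟩ := exists_adapted_basis v B hB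
  rw [hm, Finset.prod_ne_zero_iff]
  simpa using ha

theorem rk_le (v : Basis ι ℝ V) (B : Finset V) : rk B ≤ Fintype.card ι := by
  have := Module.Finite.of_basis v
  rw [← finrank_eq_card_basis v]
  exact Submodule.finrank_le _

theorem card_zmod_smul_eq_zero {q : ℕ} [NeZero q] {a : ℤ} (ha : a.natAbs ∣ q) :
    Nat.card {z : ZMod q // a • z = 0} = a.natAbs := by
  have h := IsAddCyclic.card_nsmulAddMonoidHom_ker (ZMod q) a.natAbs
  rw [Nat.card_zmod, Nat.gcd_eq_right ha] at h
  rw [← h]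
  refine Nat.card_congr (Equiv.subtypeEquivRight fun z => ?_)
  rw [AddMonoidHom.mem_ker, nsmulAddMonoidHom_apply, ← natCast_zsmul]
  rcases Int.natAbs_eq a with h | h
  · rw [← h]
  · conv_lhs => rw [h, neg_smul, neg_eq_zero]

/-- In the adapted basis the condition decouples: the image of a basis vector outside the range of
`f` is free (q choices), while the image of `b (f i)` must be `a i`-torsion (|a i| choices, since |a
i| divides q). -/
theorem card_hom_vanishing (v : Basis ι ℝ V) (B : Finset V)
    (hB : (B : Set V) ⊆ Submodule.span ℤ (Set.range v)) {q : ℕ} [NeZero q]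
    (hq : latticeMult (Submodule.span ℤ (Set.range v)) B ∣ q) :
    Nat.card {φ : Submodule.span ℤ (Set.range v) →ₗ[ℤ] ZMod q // ∀ x : Submodule.span ℤ (Set.range v),
        (x : V) ∈ B → φ x = 0} =
      q ^ (Fintype.card ι - rk B) * latticeMult (Submodule.span ℤ (Set.range v)) B := by
  classical
  obtain ⟨b, n, f, a, hspan, hrk, ha, hm⟩ := exists_adapted_basis v B hB
  rw [hm] at hq
  rw [hm, hrk]
  let L := Submodule.span ℤ (Set.range v)
  have hcrit : ∀ φ : L →ₗ[ℤ] ZMod q,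
      (∀ x : L, (x : V) ∈ B → φ x = 0) ↔ ∀ i, a i • φ (b (f i)) = 0 := by
    have key : ∀ (S : Set V) (φ : L →ₗ[ℤ] ZMod q), S ⊆ L →
        ((∀ x : L, (x : V) ∈ S → φ x = 0) ↔
          Submodule.span ℤ S ≤ (LinearMap.ker φ).map L.subtype) := by
      intro S φ hS
      rw [Submodule.span_le]
      constructor
      · intro h x hx
        exact ⟨⟨x, hS hx⟩, h ⟨x, hS hx⟩ hx, rfl⟩
      · intro h x hx
        obtain ⟨y, hy, hyx⟩ := h hx
        rw [← Subtype.ext hyx]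
        exact hy
    intro φ
    have h1 := key B φ hB
    simp only [Finset.mem_coe] at h1
    rw [h1, hspan, ← key]
    · constructor
      · intro h i
        rw [← map_smul]
        exact h _ ⟨i, rfl⟩
      · rintro h x ⟨i, hi⟩
        have : x = a i • b (f i) := Subtype.ext hi.symm
        rw [this, map_smul]
        exact h i
    · rintro _ ⟨i, rfl⟩
      exact L.smul_mem _ (b (f i)).2
  have e : {φ : L →ₗ[ℤ] ZMod q // ∀ x : L, (x : V) ∈ B → φ x = 0} ≃
      ((j : ι) → {z : ZMod q // ∀ i, f i = j → a i • z = 0}) := by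
    refine Equiv.trans ?_ (Equiv.subtypePiEquivPi (p := fun j z => ∀ i, f i = j → a i • z = 0))
    refine (Equiv.subtypeEquiv (b.constr ℤ).toEquiv ?_).symm
    intro c
    rw [hcrit]
    simp only [LinearEquiv.coe_toEquiv, Basis.constr_basis]
    constructor
    · intro h i; exact h _ i rfl
    · rintro h _ i rfl; exact h i
  rw [Nat.card_congr e, Nat.card_pi,
    ← Finset.prod_filter_mul_prod_filter_not Finset.univ (fun j => j ∈ Set.range f), mul_comm]
  congr 1
  · rw [Finset.prod_congr rfl (g := fun _ => q), Finset.prod_const]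
    · congr 1
      have h1 : (Finset.univ.filter fun j => ¬ j ∈ Set.range f) = (Finset.univ.map f)ᶜ := by
        ext j; simp
      rw [h1, Finset.card_compl, Finset.card_map, Finset.card_univ, Fintype.card_fin]
    · intro j hj
      have hj' : ∀ i, f i ≠ j := by simpa using hj
      rw [Nat.card_congr (Equiv.subtypeUnivEquiv fun z i hi => absurd hi (hj' i)), Nat.card_zmod]
  · have h1 : (Finset.univ.filter fun j => j ∈ Set.range f) = Finset.univ.map f := by
      ext j; simp
    rw [h1, Finset.prod_map]
    refine Finset.prod_congr rfl fun i _ => ?_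
    rw [← card_zmod_smul_eq_zero ((Finset.dvd_prod_of_mem _ (Finset.mem_univ i)).trans hq)]
    refine Nat.card_congr (Equiv.subtypeEquivRight fun z => ?_)
    constructor
    · intro h; exact h i rfl
    · intro h k hk; rw [f.injective hk]; exact h

theorem arithCharPoly_eq_sum {L : Submodule ℤ V} (v : Basis ι ℝ V)
    (hL : L = Submodule.span ℤ (Set.range v)) (A : Finset V) (hA : rk A = Fintype.card ι) :
    arithCharPoly L A =
      ∑ B ∈ A.powerset, (-1) ^ B.card * (latticeMult L B : ℤ[X]) * X ^ (Fintype.card ι - rk B) := by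
  subst hL
  have hfin : finrank ℤ (Submodule.span ℤ (Set.range v)) = Fintype.card ι :=
    finrank_eq_card_basis (v.restrictScalars ℤ)
  rw [arithCharPoly, hfin, hA, Nat.sub_self, pow_zero, mul_one, arithTutte, map_sum,
    Finset.mul_sum]
  refine Finset.sum_congr rfl fun B hB => ?_
  have h1 : rk B ≤ Fintype.card ι := rk_le v B
  have h2 : rk B ≤ B.card := finrank_span_finset_le_card B
  simp only [hA, map_mul, map_pow, map_sub, MvPolynomial.aeval_X, map_one, 
    map_natCast, Matrix.cons_val_zero, Matrix.cons_val_one]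
  have e1 : (1 - X - 1 : ℤ[X]) = (-1) * X := by ring
  have e2 : (0 - 1 : ℤ[X]) = -1 := by ring
  obtain ⟨k, hk⟩ := Nat.exists_eq_add_of_le h1
  obtain ⟨l, hl⟩ := Nat.exists_eq_add_of_le h2
  rw [e1, e2, mul_pow, hk, hl, Nat.add_sub_cancel_left, Nat.add_sub_cancel_left]
  have h3 : (-1 : ℤ[X]) ^ k * (-1) ^ k = 1 := by rw [← mul_pow]; simp
  simp only [pow_add]
  linear_combination ((-1) ^ rk B * (latticeMult (Submodule.span ℤ (Set.range v)) B : ℤ[X]) *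
    X ^ k * (-1) ^ l) * h3

/-- The arithmetic characteristic polynomial counts the homomorphisms to `ℤ/q` that vanish on no
element of `A`. -/
theorem eval_arithCharPoly_eq_card {L : Submodule ℤ V} (v : Basis ι ℝ V)
    (hL : L = Submodule.span ℤ (Set.range v)) (A : Finset V) (hA : rk A = Fintype.card ι)
    (hAL : (A : Set V) ⊆ L) {q : ℕ} [NeZero q] (hq : ∀ B ⊆ A, latticeMult L B ∣ q) :
    (arithCharPoly L A).eval (q : ℤ) =
      Nat.card {φ : L →ₗ[ℤ] ZMod q // ∀ x : L, (x : V) ∈ A → φ x ≠ 0} := by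
  classical
  have : Finite (L →ₗ[ℤ] ZMod q) := by
    subst hL
    exact Finite.of_equiv _ ((v.restrictScalars ℤ).constr ℤ).toEquiv
  have := Fintype.ofFinite (L →ₗ[ℤ] ZMod q)
  have hcard : ∀ B ∈ A.powerset, ((-1) ^ B.card * (latticeMult L B : ℤ) *
      (q : ℤ) ^ (Fintype.card ι - rk B)) = ∑ φ : L →ₗ[ℤ] ZMod q,
        (-1) ^ B.card * (if ∀ x : L, (x : V) ∈ B → φ x = 0 then 1 else 0) := by
    intro B hB
    rw [Finset.mem_powerset] at hB
    rw [← Finset.mul_sum, Finset.sum_boole, mul_assoc, mul_comm (latticeMult L B : ℤ)]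
    congr 1
    subst hL
    have h := card_hom_vanishing v B ((Finset.coe_subset.mpr hB).trans hAL) (hq B hB)
    rw [Nat.card_eq_fintype_card, Fintype.card_subtype] at h
    rw [h]
    push_cast
    rfl
  rw [arithCharPoly_eq_sum v hL A hA, eval_finsetSum]
  simp only [eval_mul, eval_pow, eval_neg, eval_one, eval_natCast, eval_X]
  rw [Finset.sum_congr rfl hcard, Finset.sum_comm, Nat.card_eq_fintype_card, Fintype.card_subtype,
    ← Finset.sum_boole]
  refine Finset.sum_congr rfl fun φ _ => ?_
  let g : V → ℤ := fun y => if ∀ x : L, (x : V) = y → φ x = 0 then 1 else 0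
  have hg : ∀ B : Finset V, (if ∀ x : L, (x : V) ∈ B → φ x = 0 then (1 : ℤ) else 0) =
      ∏ y ∈ B, g y := by
    intro B
    simp only [g]
    rw [Finset.prod_ite_zero]
    simp only [Finset.prod_const_one]
    congr 1
    exact propext ⟨fun h y hy x hx => h x (hx ▸ hy), fun h x hx => h x hx x rfl⟩
  simp only [hg]
  -- Inclusion-exclusion for a fixed φ: the product of the 1 - g y is 1 if φ vanishes nowhere on A,
  -- and 0 otherwise.
  have h1 : ∑ B ∈ A.powerset, (-1) ^ B.card * ∏ y ∈ B, g y = ∏ y ∈ A, (1 + -g y) := by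
    rw [Finset.prod_one_add]
    exact Finset.sum_congr rfl fun B _ => (Finset.prod_neg _).symm
  rw [h1]
  split_ifs with h
  · refine Finset.prod_eq_one fun y hy => ?_
    have : ¬ ∀ x : L, (x : V) = y → φ x = 0 := fun h' => h ⟨y, hAL hy⟩ hy (h' _ rfl)
    rw [show g y = 0 from if_neg this, neg_zero, add_zero]
  · push Not at h
    obtain ⟨x, hx, hx0⟩ := h
    refine Finset.prod_eq_zero hx ?_
    have : ∀ z : L, (z : V) = x → φ z = 0 := fun z hz => by rw [Subtype.ext hz, hx0]
    rw [show g x = 1 from if_pos this, add_neg_cancel]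

end Lattice

/-! ### The roots of type A in the weight lattice -/

section TypeAHom

open Module

theorem sum_typeAe (n : ℕ) : ∑ i, typeAe n i = 0 := by
  have h : ∑ i, typeAe n i =
      Submodule.Quotient.mk (∑ i, Pi.single i (1 : ℝ) : Fin n → ℝ) := by
    simp only [typeAe, ← Submodule.mkQ_apply, map_sum]
  rw [h, Submodule.Quotient.mk_eq_zero,
    show (∑ i, Pi.single i (1 : ℝ) : Fin n → ℝ) = fun _ => 1 from
      Finset.univ_sum_single (fun _ : Fin n => (1 : ℝ))]
  exact Submodule.mem_span_singleton_self _

theorem span_range_typeAe (n : ℕ) : Submodule.span ℝ (Set.range (typeAe n)) = ⊤ := by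
  have h := congrArg (Submodule.map (Submodule.mkQ
    (Submodule.span ℝ {(fun _ => 1 : Fin n → ℝ)}))) (Pi.basisFun ℝ (Fin n)).span_eq
  rw [Submodule.map_span, Submodule.map_top, Submodule.range_mkQ, ← Set.range_comp] at h
  rw [← h]
  congr 2
  funext i
  simp [typeAe]

theorem typeAe_zero (k : ℕ) : typeAe (k + 1) 0 = -∑ i : Fin k, typeAe (k + 1) i.succ := by
  have h := sum_typeAe (k + 1)
  rw [Fin.sum_univ_succ] at h
  exact eq_neg_of_add_eq_zero_left h

theorem finrank_typeASpace (k : ℕ) : finrank ℝ (TypeASpace (k + 1)) = k := by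
  have h := Submodule.finrank_quotient_add_finrank
    (Submodule.span ℝ {(fun _ => 1 : Fin (k + 1) → ℝ)})
  have h1 : (fun _ => 1 : Fin (k + 1) → ℝ) ≠ 0 := fun h0 => one_ne_zero (congrFun h0 0)
  rw [finrank_span_singleton h1, finrank_fin_fun] at h
  exact Nat.succ_injective h

theorem span_typeAe_succ (R : Type*) [Ring R] (k : ℕ) [Module R (TypeASpace (k + 1))] :
    Submodule.span R (Set.range fun i : Fin k => typeAe (k + 1) i.succ) =
      Submodule.span R (Set.range (typeAe (k + 1))) := by
  apply le_antisymm
  · exact Submodule.span_mono (by rintro _ ⟨i, rfl⟩; exact ⟨_, rfl⟩)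
  · rw [Submodule.span_le]
    rintro _ ⟨i, rfl⟩
    refine Fin.cases ?_ (fun j => ?_) i
    · rw [typeAe_zero]
      exact Submodule.neg_mem _ (Submodule.sum_mem _ fun j _ => Submodule.subset_span ⟨j, rfl⟩)
    · exact Submodule.subset_span ⟨j, rfl⟩

/-- The basis `e_2, …, e_n` of `ℝⁿ / ℝ(1, …, 1)`. -/
def typeABasis (k : ℕ) : Basis (Fin k) ℝ (TypeASpace (k + 1)) :=
  basisOfTopLeSpanOfCardEqFinrank (fun i : Fin k => typeAe (k + 1) i.succ)
    (by rw [span_typeAe_succ, span_range_typeAe]) (by rw [finrank_typeASpace, Fintype.card_fin])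

theorem coe_typeABasis (k : ℕ) :
    (typeABasis k : Fin k → TypeASpace (k + 1)) = fun i => typeAe (k + 1) i.succ :=
  coe_basisOfTopLeSpanOfCardEqFinrank _ _ _

theorem typeAWeightLattice_eq (k : ℕ) :
    typeAWeightLattice (k + 1) = Submodule.span ℤ (Set.range (typeABasis k)) := by
  rw [coe_typeABasis, span_typeAe_succ, typeAWeightLattice]

theorem typeAe_mem (n : ℕ) (i : Fin n) : typeAe n i ∈ typeAWeightLattice n :=
  Submodule.subset_span ⟨i, rfl⟩

theorem mem_typeARoots {n : ℕ} {y : TypeASpace n} :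
    y ∈ typeARoots n ↔ ∃ i j, i < j ∧ typeAe n i - typeAe n j = y := by
  simp [typeARoots]

theorem typeARoots_subset (n : ℕ) :
    (typeARoots n : Set (TypeASpace n)) ⊆ typeAWeightLattice n := by
  intro y hy
  obtain ⟨i, j, -, rfl⟩ := mem_typeARoots.mp hy
  exact Submodule.sub_mem _ (typeAe_mem n i) (typeAe_mem n j)

theorem rk_typeARoots (k : ℕ) : rk (typeARoots (k + 1)) = k := by
  have hmem : ∀ i j, typeAe (k + 1) i - typeAe (k + 1) j ∈
      Submodule.span ℝ (typeARoots (k + 1) : Set (TypeASpace (k + 1))) := by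
    intro i j
    rcases lt_trichotomy i j with h | rfl | h
    · exact Submodule.subset_span (mem_typeARoots.mpr ⟨i, j, h, rfl⟩)
    · rw [sub_self]; exact Submodule.zero_mem _
    · rw [← neg_sub]
      exact Submodule.neg_mem _ (Submodule.subset_span (mem_typeARoots.mpr ⟨j, i, h, rfl⟩))
  have htop : Submodule.span ℝ (typeARoots (k + 1) : Set (TypeASpace (k + 1))) = ⊤ := by
    rw [eq_top_iff, ← span_range_typeAe, Submodule.span_le]
    rintro _ ⟨i, rfl⟩
    -- As the e_j sum to zero, n e_i is a sum of differences; dividing by n puts e_i in the real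
    -- span.
    have h1 : ∑ j, (typeAe (k + 1) i - typeAe (k + 1) j) = ((k + 1 : ℕ) : ℝ) • typeAe (k + 1) i := by
      rw [Finset.sum_sub_distrib, sum_typeAe, sub_zero, Finset.sum_const, Finset.card_univ,
        Fintype.card_fin, Nat.cast_smul_eq_nsmul]
    have h2 := Submodule.sum_mem (Submodule.span ℝ (typeARoots (k + 1) : Set (TypeASpace (k + 1))))
      fun j (_ : j ∈ Finset.univ) => hmem i j
    rw [h1] at h2
    exact (Submodule.smul_mem_iff _ (Nat.cast_ne_zero.mpr k.succ_ne_zero)).mp h2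
  rw [rk, htop, finrank_top, finrank_typeASpace]

/-- Homomorphisms from the weight lattice to `M` are tuples in `M` with sum zero. -/
theorem bijective_hom_typeAWeightLattice (k : ℕ) (M : Type*) [AddCommGroup M] :
    Function.Bijective (fun φ : typeAWeightLattice (k + 1) →ₗ[ℤ] M =>
      (⟨fun i => φ ⟨_, typeAe_mem _ i⟩, by
        rw [← map_sum]
        convert map_zero φ
        apply Subtype.ext
        simpa using sum_typeAe (k + 1)⟩ : {x : Fin (k + 1) → M // ∑ i, x i = 0})) := by
  constructor
  · intro φ ψ h
    have h' : ∀ i, φ ⟨_, typeAe_mem _ i⟩ = ψ ⟨_, typeAe_mem _ i⟩ :=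
      fun i => congrFun (congrArg Subtype.val h) i
    have hs : Submodule.span ℤ (Set.range (typeAe (k + 1))) ≤
        (LinearMap.eqLocus φ ψ).map (Submodule.subtype _) := by
      rw [Submodule.span_le]
      rintro _ ⟨i, rfl⟩
      exact ⟨⟨_, typeAe_mem _ i⟩, h' i, rfl⟩
    ext x
    obtain ⟨y, hy, hyx⟩ := hs x.2
    rw [← Subtype.ext hyx]
    exact hy
  · rintro ⟨x, hx⟩
    -- Values on the basis e_2, …, e_n can be prescribed freely; the value at e_1 is then forced,
    -- and agrees because the tuple sums to zero.
    let b : Basis (Fin k) ℤ (typeAWeightLattice (k + 1)) :=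
      ((typeABasis k).restrictScalars ℤ).map
        (LinearEquiv.ofEq _ _ (typeAWeightLattice_eq k).symm)
    have hb : ∀ i, b i = ⟨_, typeAe_mem _ i.succ⟩ := by
      intro i
      apply Subtype.ext
      simp [b, coe_typeABasis]
    have hs : ∀ i : Fin k, b.constr ℤ (fun i => x i.succ) ⟨_, typeAe_mem _ i.succ⟩ = x i.succ := by
      intro i
      rw [← hb, Basis.constr_basis]
    refine ⟨b.constr ℤ fun i => x i.succ, Subtype.ext (funext fun i => ?_)⟩
    refine Fin.cases ?_ (fun j => hs j) i
    have h0 : (⟨_, typeAe_mem (k + 1) 0⟩ : typeAWeightLattice (k + 1)) =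
        -∑ i : Fin k, ⟨_, typeAe_mem _ i.succ⟩ := by
      apply Subtype.ext
      simpa using typeAe_zero k
    rw [Fin.sum_univ_succ] at hx
    simp only [h0, map_neg, map_sum, hs]
    exact (eq_neg_of_add_eq_zero_left hx).symm

theorem card_hom_typeARoots (k q : ℕ) :
    Nat.card {φ : typeAWeightLattice (k + 1) →ₗ[ℤ] ZMod q //
        ∀ x : typeAWeightLattice (k + 1), (x : TypeASpace (k + 1)) ∈ typeARoots (k + 1) → φ x ≠ 0} =
      Nat.card {x : Fin (k + 1) → ZMod q // ∑ i, x i = 0 ∧ Function.Injective x} := by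
  refine Nat.card_congr (Equiv.trans ?_ (Equiv.subtypeSubtypeEquivSubtypeInter
    (fun x : Fin (k + 1) → ZMod q => ∑ i, x i = 0) Function.Injective))
  refine Equiv.subtypeEquiv (Equiv.ofBijective _ (bijective_hom_typeAWeightLattice k _)) ?_
  intro φ
  have hsub : ∀ i j, φ ⟨_, typeAe_mem _ i⟩ - φ ⟨_, typeAe_mem _ j⟩ =
      φ ⟨_, Submodule.sub_mem _ (typeAe_mem _ i) (typeAe_mem _ j)⟩ := by
    intro i j
    rw [← map_sub]
    rfl
  simp only [Equiv.ofBijective_apply]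
  constructor
  · intro h i j hij
    by_contra hne
    rcases lt_or_gt_of_ne hne with hlt | hlt
    · exact h ⟨_, Submodule.sub_mem _ (typeAe_mem _ i) (typeAe_mem _ j)⟩
        (mem_typeARoots.mpr ⟨i, j, hlt, rfl⟩) (by rw [← hsub]; exact sub_eq_zero.mpr hij)
    · exact h ⟨_, Submodule.sub_mem _ (typeAe_mem _ j) (typeAe_mem _ i)⟩
        (mem_typeARoots.mpr ⟨j, i, hlt, rfl⟩) (by rw [← hsub]; exact sub_eq_zero.mpr hij.symm)
  · rintro h ⟨x, hx'⟩ hx h0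
    obtain ⟨i, j, hlt, rfl⟩ := mem_typeARoots.mp hx
    rw [← hsub, sub_eq_zero] at h0
    exact hlt.ne (h h0)

/-- The characteristic polynomial of the type `A` roots in the weight lattice counts injective
tuples in `ℤ/q` with sum zero, for suitably divisible `q`. -/
theorem exists_eval_typeAWeightCharPoly (k : ℕ) : ∃ N : ℕ, N ≠ 0 ∧ ∀ q : ℕ, q ≠ 0 → N ∣ q →
    (typeAWeightCharPoly (k + 1)).eval (q : ℤ) =
      Nat.card {x : Fin (k + 1) → ZMod q // ∑ i, x i = 0 ∧ Function.Injective x} := by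
  refine ⟨∏ B ∈ (typeARoots (k + 1)).powerset, latticeMult (typeAWeightLattice (k + 1)) B, ?_, ?_⟩
  · rw [Finset.prod_ne_zero_iff]
    intro B hB
    have hB' : (B : Set (TypeASpace (k + 1))) ⊆ typeAWeightLattice (k + 1) :=
      (Finset.coe_subset.mpr (Finset.mem_powerset.mp hB)).trans (typeARoots_subset _)
    rw [typeAWeightLattice_eq] at hB' ⊢
    exact latticeMult_ne_zero _ _ hB'
  · intro q hq hN
    have : NeZero q := ⟨hq⟩
    rw [typeAWeightCharPoly, eval_arithCharPoly_eq_card (typeABasis k) (typeAWeightLattice_eq k) _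
      (by rw [rk_typeARoots, Fintype.card_fin]) (typeARoots_subset _), card_hom_typeARoots]
    intro B hB
    exact (Finset.dvd_prod_of_mem _ (Finset.mem_powerset.mpr hB)).trans hN

end TypeAHom

/-! ### Zero-sum tuples of distinct residues, by characters -/

section Counting

/-- Each n-subset is the image of exactly n! injective tuples, all giving the same product. -/
theorem sum_injective_prod {α R : Type*} [Fintype α] [DecidableEq α] [CommRing R] (n : ℕ)
    (f : α → R) :
    ∑ x : Fin n → α with Function.Injective x, ∏ i, f (x i) =
      n.factorial * ∑ S ∈ Finset.univ.powersetCard n, ∏ s ∈ S, f s := by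
  classical
  have hmaps : ∀ x ∈ Finset.univ.filter (fun x : Fin n → α => Function.Injective x),
      Finset.univ.image x ∈ (Finset.univ : Finset α).powersetCard n := by
    intro x hx
    rw [Finset.mem_powersetCard]
    refine ⟨Finset.subset_univ _, ?_⟩
    rw [Finset.card_image_of_injective _ (Finset.mem_filter.mp hx).2, Finset.card_univ,
      Fintype.card_fin]
  rw [← Finset.sum_fiberwise_of_maps_to hmaps, Finset.mul_sum]
  refine Finset.sum_congr rfl fun S hS => ?_
  have hScard := (Finset.mem_powersetCard.mp hS).2
  rw [Finset.sum_congr rfl (g := fun _ => ∏ s ∈ S, f s)]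
  · rw [Finset.sum_const, nsmul_eq_mul]
    congr 2
    have e : {x : Fin n → α // Function.Injective x ∧ Finset.univ.image x = S} ≃ (Fin n ≃ S) :=
      { toFun := fun x => Equiv.ofBijective
          (fun i => (⟨x.1 i, by simp [Finset.ext_iff.mp x.2.2.symm]⟩ : S))
          ⟨fun i j h => x.2.1 (congrArg Subtype.val h), by
            rintro ⟨s, hs⟩
            rw [← x.2.2, Finset.mem_image] at hs
            obtain ⟨i, -, rfl⟩ := hs
            exact ⟨i, rfl⟩⟩
        invFun := fun e => ⟨fun i => e i, fun i j h => e.injective (Subtype.ext h), by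
          ext s
          simp only [Finset.mem_image, Finset.mem_univ, true_and]
          exact ⟨by rintro ⟨i, rfl⟩; exact (e i).2, fun hs => ⟨e.symm ⟨s, hs⟩, by simp⟩⟩⟩
        left_inv := fun x => rfl
        right_inv := fun e => Equiv.ext fun i => rfl }
    rw [Finset.filter_filter, ← Fintype.card_subtype, Fintype.card_congr e,
      Fintype.card_equiv ((Fintype.equivFinOfCardEq (by simpa using hScard)).symm),
      Fintype.card_fin]
  · intro x hx
    rw [Finset.mem_filter, Finset.mem_filter] at hx
    rw [← hx.2, Finset.prod_image fun i _ j _ h => hx.1.2 h]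

theorem prod_one_add_C_mul_X_coeff {α R : Type*} [Fintype α] [CommRing R] (n : ℕ) (f : α → R) :
    (∏ s, (1 + C (f s) * X)).coeff n = ∑ S ∈ Finset.univ.powersetCard n, ∏ s ∈ S, f s := by
  classical
  rw [Finset.prod_one_add, finsetSum_coeff]
  simp only [Finset.prod_mul_distrib, Finset.prod_const, ← map_prod, coeff_C_mul, coeff_X_pow]
  rw [Finset.powersetCard_eq_filter, Finset.sum_filter]
  refine Finset.sum_congr rfl fun S _ => ?_
  by_cases h : S.card = n
  · simp [h]
  · simp [h, Ne.symm h]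

theorem prod_range_one_add_primitiveRoot {R : Type*} [CommRing R] [IsDomain R] {ζ : R} {m : ℕ}
    (hm : 0 < m) (hζ : IsPrimitiveRoot ζ m) :
    ∏ i ∈ Finset.range m, (1 + C (ζ ^ i) * X : R[X]) = 1 - (-X) ^ m := by
  classical
  have hζ' : IsPrimitiveRoot (C ζ) m := hζ.map_of_injective (f := C) C_injective
  have h := hζ'.pow_sub_pow_eq_prod_sub_mul 1 (-X) hm
  rw [one_pow] at h
  rw [h]
  have himg : nthRootsFinset m (1 : R[X]) = (Finset.range m).image fun i => (C ζ) ^ i := by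
    ext z
    rw [mem_nthRootsFinset hm, Finset.mem_image]
    constructor
    · intro hz
      have : NeZero m := ⟨hm.ne'⟩
      obtain ⟨i, hi, rfl⟩ := hζ'.eq_pow_of_pow_eq_one hz
      exact ⟨i, Finset.mem_range.mpr hi, rfl⟩
    · rintro ⟨i, -, rfl⟩
      rw [← pow_mul, mul_comm, pow_mul, hζ'.pow_eq_one, one_pow]
  rw [himg, Finset.prod_image]
  · refine Finset.prod_congr rfl fun i _ => ?_
    rw [C_pow]; ring
  · intro i hi j hj hij
    exact hζ'.pow_inj (by simpa using hi) (by simpa using hj) hij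

theorem prod_range_mul_one_add_primitiveRoot {R : Type*} [CommRing R] [IsDomain R] {ζ : R} {m : ℕ}
    (hm : 0 < m) (hζ : IsPrimitiveRoot ζ m) (l : ℕ) :
    ∏ i ∈ Finset.range (m * l), (1 + C (ζ ^ i) * X : R[X]) = (1 - (-X) ^ m) ^ l := by
  induction l with
  | zero => simp
  | succ l ih =>
    rw [Nat.mul_succ, Finset.prod_range_add, ih, pow_succ,
      ← prod_range_one_add_primitiveRoot hm hζ]
    congr 1
    refine Finset.prod_congr rfl fun i _ => ?_
    rw [pow_add, pow_mul, hζ.pow_eq_one, one_pow, one_mul]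

theorem coeff_one_sub_neg_X_pow {R : Type*} [CommRing R] {m : ℕ} (hm : 0 < m) (l n : ℕ) :
    ((1 - (-X) ^ m : R[X]) ^ l).coeff n =
      if m ∣ n then (-1) ^ (n - n / m) * (l.choose (n / m) : R) else 0 := by
  have h1 : (1 - (-X) ^ m : R[X]) = 1 + C (-(-1) ^ m) * X ^ m := by
    rw [neg_pow (X : R[X]) m, C_neg, C_pow, C_neg, C_1]; ring
  have h2 : ∀ j, (-(-1 : R) ^ m) ^ j = (-1) ^ (m * j - j) := by
    intro j
    obtain ⟨m, rfl⟩ := Nat.exists_eq_succ_of_ne_zero hm.ne'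
    rw [Nat.succ_mul, Nat.add_sub_cancel, pow_mul, pow_succ]
    ring
  rw [h1, add_comm, add_pow, finsetSum_coeff]
  simp only [one_pow, mul_one, mul_pow, ← pow_mul, ← C_pow]
  have h3 : ∀ j, (C ((-(-1 : R) ^ m) ^ j) * X ^ (m * j) * (l.choose j : R[X])).coeff n =
      if n = m * j then (-1) ^ (m * j - j) * (l.choose j : R) else 0 := by
    intro j
    rw [← C_eq_natCast, mul_right_comm, ← C_mul, coeff_C_mul, coeff_X_pow, h2]
    split_ifs <;> simp
  simp only [h3]
  split_ifs with hd
  · obtain ⟨j, rfl⟩ := hd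
    rw [Nat.mul_div_cancel_left _ hm, Finset.sum_eq_single j]
    · simp
    · intro i _ hij
      rw [if_neg]
      exact fun h => hij (Nat.eq_of_mul_eq_mul_left hm h).symm
    · intro hj
      rw [Nat.choose_eq_zero_of_lt (by simpa using hj)]
      simp
  · refine Finset.sum_eq_zero fun j _ => if_neg ?_
    rintro rfl
    exact hd (dvd_mul_right _ _)

theorem isPrimitiveRoot_stdAddChar {q : ℕ} [NeZero q] (a : ZMod q) :
    IsPrimitiveRoot (ZMod.stdAddChar a) (addOrderOf a) := by
  rw [IsPrimitiveRoot.iff_def]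
  constructor
  · rw [← AddChar.map_nsmul_eq_pow, addOrderOf_nsmul_eq_zero, AddChar.map_zero_eq_one]
  · intro l hl
    rw [← AddChar.map_nsmul_eq_pow, ← AddChar.map_zero_eq_one (ZMod.stdAddChar (N := q))] at hl
    exact addOrderOf_dvd_of_nsmul_eq_zero (ZMod.injective_stdAddChar hl)

theorem addChar_map_sum {A M ι : Type*} [AddCommMonoid A] [CommMonoid M] (ψ : AddChar A M)
    (s : Finset ι) (x : ι → A) : ψ (∑ i ∈ s, x i) = ∏ i ∈ s, ψ (x i) := by
  classical
  induction s using Finset.induction_on with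
  | empty => simp
  | insert i s hi ih =>
    rw [Finset.sum_insert hi, Finset.prod_insert hi, AddChar.map_add_eq_mul, ih]

/-- As s runs over ℤ/q, ψ(sa) = ψ(a)^s runs q/m times through the m-th roots of unity, m being the
order of a. -/
theorem prod_one_add_stdAddChar {q : ℕ} [NeZero q] (a : ZMod q) :
    ∏ s : ZMod q, (1 + C (ZMod.stdAddChar (s * a)) * X) =
      (1 - (-X) ^ addOrderOf a) ^ (q / addOrderOf a) := by
  have hd : addOrderOf a ∣ q := by simpa using addOrderOf_dvd_card (x := a)
  rw [← prod_range_mul_one_add_primitiveRoot (addOrderOf_pos a) (isPrimitiveRoot_stdAddChar a),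
    Nat.mul_div_cancel' hd]
  refine Finset.prod_nbij' ZMod.val (fun i => (i : ZMod q)) ?_ ?_ ?_ ?_ ?_
  · exact fun s _ => Finset.mem_range.mpr s.val_lt
  · exact fun _ _ => Finset.mem_univ _
  · exact fun s _ => ZMod.natCast_zmod_val s
  · exact fun i hi => ZMod.val_cast_of_lt (Finset.mem_range.mp hi)
  · intro s _
    rw [← AddChar.map_nsmul_eq_pow, nsmul_eq_mul, ZMod.natCast_zmod_val]

/-- The number of injective `n`-tuples in `ℤ/q` with sum zero. -/
theorem card_injective_sum_eq_zero {n q : ℕ} (hq : q ≠ 0) (hnq : n ∣ q) :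
    (q : ℂ) * Nat.card {x : Fin n → ZMod q // ∑ i, x i = 0 ∧ Function.Injective x} =
      n.factorial * ∑ m ∈ n.divisors,
        (-1) ^ (n - n / m) * (m.totient : ℂ) * ((q / m).choose (n / m) : ℂ) := by
  classical
  have : NeZero q := ⟨hq⟩
  have hn : n ≠ 0 := by rintro rfl; exact hq (zero_dvd_iff.mp hnq)
  -- Orthogonality: the inner sum over a is q if the tuple sums to zero and 0 otherwise.
  have h1 : (q : ℂ) * Nat.card {x : Fin n → ZMod q // ∑ i, x i = 0 ∧ Function.Injective x} =
      ∑ x : Fin n → ZMod q with Function.Injective x,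
        ∑ a : ZMod q, ZMod.stdAddChar (a * ∑ i, x i) := by
    simp only [AddChar.sum_mulShift _ (ZMod.isPrimitive_stdAddChar q), ZMod.card]
    rw [Nat.card_eq_fintype_card, Fintype.card_subtype, ← Finset.sum_boole, Finset.mul_sum,
      Finset.sum_filter]
    refine Finset.sum_congr rfl fun x _ => ?_
    by_cases hx : Function.Injective x <;> by_cases hs : ∑ i, x i = 0 <;> simp [hx, hs]
  have h2 : ∀ a : ZMod q, ∑ x : Fin n → ZMod q with Function.Injective x,
      ZMod.stdAddChar (a * ∑ i, x i) = (n.factorial : ℂ) *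
        ((1 - (-X) ^ addOrderOf a : ℂ[X]) ^ (q / addOrderOf a)).coeff n := by
    intro a
    rw [← prod_one_add_stdAddChar, prod_one_add_C_mul_X_coeff, ← sum_injective_prod]
    refine Finset.sum_congr rfl fun x _ => ?_
    rw [Finset.mul_sum, addChar_map_sum]
    simp only [mul_comm a]
  rw [h1, Finset.sum_comm]
  simp only [h2]
  rw [← Finset.mul_sum]
  congr 1
  have hmaps : ∀ a ∈ (Finset.univ : Finset (ZMod q)), addOrderOf a ∈ q.divisors := by
    intro a _
    rw [Nat.mem_divisors]
    exact ⟨by simpa using addOrderOf_dvd_card (x := a), hq⟩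
  rw [← Finset.sum_fiberwise_of_maps_to hmaps]
  -- Only orders dividing n contribute; since n ∣ q, every divisor of n does occur as an order.
  rw [← Finset.sum_subset (Nat.divisors_subset_of_dvd hq hnq)]
  · refine Finset.sum_congr rfl fun m hm => ?_
    have hmn := (Nat.mem_divisors.mp hm).1
    have hm0 : 0 < m := Nat.pos_of_mem_divisors hm
    rw [Finset.sum_congr rfl (g := fun _ => (-1) ^ (n - n / m) * ((q / m).choose (n / m) : ℂ)),
      Finset.sum_const, IsAddCyclic.card_addOrderOf_eq_totient (by simpa using hmn.trans hnq),
      nsmul_eq_mul]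
    · ring
    · intro a ha
      rw [(Finset.mem_filter.mp ha).2, coeff_one_sub_neg_X_pow hm0, if_pos hmn]
  · intro m hm hmn
    refine Finset.sum_eq_zero fun a ha => ?_
    rw [(Finset.mem_filter.mp ha).2, coeff_one_sub_neg_X_pow (Nat.pos_of_mem_divisors hm), if_neg]
    exact fun h => hmn (Nat.mem_divisors.mpr ⟨h, hn⟩)

end Counting

/-! ### From divisible integers to a polynomial identity -/

section Main

theorem exists_mul_eval_typeAWeightCharPoly {n : ℕ} (hn : n ≠ 0) :
    ∃ N : ℕ, N ≠ 0 ∧ n ∣ N ∧ ∀ q : ℕ, q ≠ 0 → N ∣ q →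
      (q : ℤ) * (typeAWeightCharPoly n).eval (q : ℤ) =
        n.factorial * ∑ m ∈ n.divisors,
          (-1) ^ (n - n / m) * (m.totient : ℤ) * ((q / m).choose (n / m) : ℤ) := by
  obtain ⟨k, rfl⟩ := Nat.exists_eq_succ_of_ne_zero hn
  obtain ⟨N, hN, h⟩ := exists_eval_typeAWeightCharPoly k
  -- The extra factor n makes q/m an exact quotient for every m ∣ n.
  refine ⟨N * k.succ, mul_ne_zero hN hn, dvd_mul_left _ _, fun q hq hNq => ?_⟩
  have h1 := card_injective_sum_eq_zero hq ((dvd_mul_left _ _).trans hNq)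
  rw [h q hq ((dvd_mul_right _ _).trans hNq)]
  exact_mod_cast h1

theorem choose_eq_eval_descPochhammer {K : Type*} [Field K] [CharZero K] (r : K) (k : ℕ) :
    Ring.choose r k = (k.factorial : K)⁻¹ * (descPochhammer K k).eval r := by
  have h := Ring.descPochhammer_eq_factorial_smul_choose r k
  rw [← aeval_eq_smeval, ← eval_map_algebraMap, descPochhammer_map, nsmul_eq_mul] at h
  rw [h, inv_mul_cancel_left₀ (by exact_mod_cast k.factorial_ne_zero)]

theorem mul_aeval_typeAWeightCharPoly {n : ℕ} (hn : n ≠ 0) {K : Type*} [Field K] [CharZero K]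
    (q : K) :
    q * aeval q (typeAWeightCharPoly n) = n.factorial * ∑ m ∈ n.divisors,
      (-1) ^ (n - n / m) * (m.totient : K) * Ring.choose (q / (m : K)) (n / m) := by
  obtain ⟨N, hN, hnN, h⟩ := exists_mul_eval_typeAWeightCharPoly hn
  let P : K[X] := C (n.factorial : K) * ∑ m ∈ n.divisors,
    C ((-1) ^ (n - n / m) * (m.totient : K) * ((n / m).factorial : K)⁻¹) *
      (descPochhammer K (n / m)).comp (C (m : K)⁻¹ * X)
  have hP : ∀ r : K, P.eval r = n.factorial * ∑ m ∈ n.divisors,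
      (-1) ^ (n - n / m) * (m.totient : K) * Ring.choose (r / (m : K)) (n / m) := by
    intro r
    simp only [P, eval_mul, eval_C, eval_finsetSum, eval_comp, eval_X,
      choose_eq_eval_descPochhammer]
    congr 1
    refine Finset.sum_congr rfl fun m _ => ?_
    rw [div_eq_inv_mul]
    ring
  -- Both sides are polynomials agreeing at all positive multiples of N, which are infinitely many
  -- in characteristic 0.
  have hEq : X * (typeAWeightCharPoly n).map (algebraMap ℤ K) = P := by
    refine eq_of_infinite_eval_eq _ _ (Set.infinite_of_injective_forall_mem
      (f := fun j : ℕ => ((N * (j + 1) : ℕ) : K)) ?_ fun j => ?_)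
    · intro i j hij
      have := Nat.eq_of_mul_eq_mul_left (Nat.pos_of_ne_zero hN) (Nat.cast_injective hij)
      omega
    · have hj := congrArg (Int.cast : ℤ → K)
        (h (N * (j + 1)) (mul_ne_zero hN j.succ_ne_zero) (dvd_mul_right _ _))
      have hev : (((typeAWeightCharPoly n).eval ((N * (j + 1) : ℕ) : ℤ) : ℤ) : K) =
          aeval ((N * (j + 1) : ℕ) : K) (typeAWeightCharPoly n) := by
        have := aeval_algebraMap_apply K ((N * (j + 1) : ℕ) : ℤ) (typeAWeightCharPoly n)
        simpa using this.symm
      rw [Set.mem_ofPred_eq, eval_mul, eval_X, eval_map_algebraMap, hP]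
      rw [Int.cast_mul, hev, Int.cast_natCast] at hj
      rw [hj, Int.cast_mul, Int.cast_natCast, Int.cast_sum]
      congr 1
      refine Finset.sum_congr rfl fun m hm => ?_
      have hmd : m ∣ N * (j + 1) :=
        ((Nat.dvd_of_mem_divisors hm).trans hnN).trans (dvd_mul_right _ _)
      rw [← Nat.cast_div hmd (Nat.cast_ne_zero.mpr (Nat.pos_of_mem_divisors hm).ne'),
        Ring.choose_natCast]
      push_cast
      rfl
  rw [← hP, ← hEq, eval_mul, eval_X, eval_map_algebraMap]

theorem typeAWeightCharPoly_of_prime {n : ℕ} (hn : 3 ≤ n) (hp : n.Prime) :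
    typeAWeightCharPoly n = (∏ i ∈ Finset.Icc 1 (n - 1), (X - C (i : ℤ))) +
      C (((n - 1) * (n - 1).factorial : ℕ) : ℤ) := by
  have hn0 : n ≠ 0 := by omega
  refine eq_of_infinite_eval_eq _ _ (Set.infinite_of_injective_forall_mem
    (f := fun j : ℕ => ((j + 1 : ℕ) : ℤ)) (fun i j hij => by simpa using hij) fun j => ?_)
  have h := mul_aeval_typeAWeightCharPoly hn0 (((j + 1 : ℕ) : ℤ) : ℚ)
  -- This is where n = 2 is excluded: the term m = n carries the sign (-1)^(n-1).
  have hodd : Even (n - 1) := by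
    rcases hp.eq_two_or_odd' with h2 | h2
    · omega
    · exact Nat.Odd.sub_odd h2 odd_one
  have hev : aeval (((j + 1 : ℕ) : ℤ) : ℚ) (typeAWeightCharPoly n) =
      (((typeAWeightCharPoly n).eval ((j + 1 : ℕ) : ℤ) : ℤ) : ℚ) := by
    have := aeval_algebraMap_apply ℚ ((j + 1 : ℕ) : ℤ) (typeAWeightCharPoly n)
    simpa using this
  rw [hev, hp.divisors, Finset.sum_pair hp.one_lt.ne, Nat.div_one, Nat.sub_self, pow_zero,
    Nat.div_self hp.pos, hodd.neg_one_pow, Ring.choose_one_right, Nat.totient_one,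
    Nat.totient_prime hp, choose_eq_eval_descPochhammer, descPochhammer_eval_eq_prod_range] at h
  obtain ⟨k, rfl⟩ := Nat.exists_eq_succ_of_ne_zero hn0
  rw [Finset.prod_range_succ'] at h
  have hIcc : Finset.Icc 1 (k.succ - 1) = (Finset.range k).map ⟨Nat.succ, Nat.succ_injective⟩ := by
    ext i
    simp only [Finset.mem_Icc, Finset.mem_map, Finset.mem_range, Function.Embedding.coeFn_mk]
    constructor
    · rintro ⟨h1, h2⟩
      exact ⟨i - 1, by omega, by omega⟩
    · rintro ⟨a, h1, rfl⟩
      omega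
  rw [Set.mem_ofPred_eq, hIcc, Finset.prod_map, eval_add, eval_prod, eval_C]
  simp only [Function.Embedding.coeFn_mk, eval_sub, eval_X, eval_C]
  have hq : (((j + 1 : ℕ) : ℤ) : ℚ) ≠ 0 := by exact_mod_cast j.succ_ne_zero
  have hk : ((k.succ : ℕ) : ℚ) ≠ 0 := by exact_mod_cast k.succ_ne_zero
  have hfk : (k.succ.factorial : ℚ) = (k.succ : ℚ) * (k.factorial : ℚ) := by
    rw [Nat.factorial_succ, Nat.cast_mul]
  rw [← Int.cast_inj (α := ℚ)]
  apply mul_left_cancel₀ hq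
  rw [h]
  generalize hr : (((j + 1 : ℕ) : ℤ) : ℚ) = r at hq ⊢
  simp only [Nat.succ_sub_one, Int.cast_add, Int.cast_prod, Int.cast_sub, Int.cast_natCast,
    Nat.cast_mul]
  have hd : ∀ x : ℚ, x / ((1 : ℕ) : ℚ) = x := fun x => by rw [Nat.cast_one, div_one]
  simp only [hd]
  rw [← Int.cast_natCast (R := ℚ) (j + 1), hr, hfk]
  push_cast at hk ⊢
  field_simp
  ring

end Main

end ArithTutte

end

theorem theorem1p12 (n : ℕ) (hn : 1 ≤ n) :
    (∀ (K : Type*) [Field K] [CharZero K] (q : K), q ≠ 0 →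
      Polynomial.aeval q (ArithTutte.typeAWeightCharPoly n) =
        (n.factorial : K) / q *
          ∑ m ∈ n.divisors,
            (-1) ^ (n - n / m) * (m.totient : K) * Ring.choose (q / (m : K)) (n / m)) ∧
    (3 ≤ n → n.Prime →
      ArithTutte.typeAWeightCharPoly n =
        (∏ i ∈ Finset.Icc 1 (n - 1), (Polynomial.X - Polynomial.C (i : ℤ))) +
          Polynomial.C (((n - 1) * (n - 1).factorial : ℕ) : ℤ)) := by
  refine ⟨fun K _ _ q hq => ?_, ArithTutte.typeAWeightCharPoly_of_prime⟩
  rw [div_mul_eq_mul_div, ← ArithTutte.mul_aeval_typeAWeightCharPoly (by omega),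
    mul_div_cancel_left₀ _ hq]
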